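/- Conventions. $S^d\subset\mathbb{R}^{d+1}$ is the unit sphere with the geodesic metric (the distance of two points is the angle between them) and the antipodal involution $x\mapsto -x$; $\mathbb{R}P^d=S^d/\{\pm1\}$ has the quotient metric, so that the distance of two points is the angle between the lines they determine. For a compact metric space $X$, let $p_m(X)$ be the supremum of all $\varepsilon>0$ for which there are $x_1,\dots,x_m\in X$ with $d(x_i,x_j)\ge\varepsilon$ for all $i\ne j$. For a compact metric space $X$ with a free involution $x\mapsto -x$, let $c_n(X)$ be the infimum of all $t\in[0,\infty)$ such that for every continuous odd map $f\colon X\to\mathbb{R}^n$ (that is, $f(-x)=-f(x)$ for all $x$) there is a set $A\subset X$ with $\mathrm{diam}(A)\le t$ and $0\in\mathrm{conv}(f(A))$. Theorem. Let $n\ge d\ge 1$ be integers and let $A_1,\dots,A_{n+1}$ be subsets of $S^d$ that cover $S^d$ and such that each of the first $n$ sets $A_1,\dots,A_n$ is open or closed (the set $A_{n+1}$ is arbitrary). Suppose that every subset of $S^d$ of diameter at most $c_n(S^d)$ is contained in some $A_i$. Then some $A_i$, $1\le i\le n+1$, contains a pair of antipodal points $x,-x$. In particular, the hypothesis is satisfied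 if every subset of $S^d$ of diameter at most $\pi-p_{n+1}(\mathbb{R}P^d)$ is contained in some $A_i$; that is, in this case every subset of $S^d$ of diameter at most $c_n(S^d)$ is contained in some $A_i$. -/

import Mathlib

namespace ProjCode

/-- The unit sphere `S^d` in `ℝ^{d+1}`. This is a synonym of Mathlib's sphere which carries the
geodesic (angular) metric instead of the chordal one. -/
def Sphere (d : ℕ) : Type :=
  Metric.sphere (0 : EuclideanSpace ℝ (Fin (d + 1))) 1

namespace Sphere

variable {d : ℕ}

/-- The underlying vector of a point of the sphere. -/
def vec (x : Sphere d) : EuclideanSpace ℝ (Fin (d + 1)) := Subtype.val x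

theorem norm_vec (x : Sphere d) : ‖x.vec‖ = 1 := mem_sphere_zero_iff_norm.1 (Subtype.property x)

theorem vec_injective : Function.Injective (vec : Sphere d → _) := Subtype.val_injective

/-- The antipodal involution on the sphere. -/
noncomputable instance : InvolutiveNeg (Sphere d) :=
  inferInstanceAs (InvolutiveNeg (Metric.sphere (0 : EuclideanSpace ℝ (Fin (d + 1))) 1))

theorem vec_neg (x : Sphere d) : (-x).vec = -x.vec := rfl

/-- The usual (subspace) topology on the sphere. -/
instance : TopologicalSpace (Sphere d) :=
  inferInstanceAs (TopologicalSpace (Metric.sphere (0 : EuclideanSpace ℝ (Fin (d + 1))) 1))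

instance : CompactSpace (Sphere d) :=
  inferInstanceAs (CompactSpace (Metric.sphere (0 : EuclideanSpace ℝ (Fin (d + 1))) 1))

theorem continuous_vec : Continuous (vec : Sphere d → _) := continuous_subtype_val

theorem isEmbedding_vec : Topology.IsEmbedding (vec : Sphere d → _) :=
  Topology.IsEmbedding.subtypeVal

/-- The geodesic metric: the distance of two points is the angle between them. -/
noncomputable abbrev angularMetric (d : ℕ) : MetricSpace (Sphere d) where
  dist x y := InnerProductGeometry.angle x.vec y.vec
  dist_self x := InnerProductGeometry.angle_self (norm_ne_zero_iff.1 (by simp [norm_vec]))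
  dist_comm x y := InnerProductGeometry.angle_comm _ _
  dist_triangle x y z := InnerProductGeometry.angle_le_angle_add_angle _ _ _
  eq_of_dist_eq_zero {x y} h := by
    apply vec_injective
    have h1 := InnerProductGeometry.inner_eq_mul_norm_of_angle_eq_zero h
    rw [norm_vec, norm_vec, one_mul] at h1
    exact (inner_eq_one_iff_of_norm_eq_one (norm_vec x) (norm_vec y)).1 h1

/-- The geodesic metric induces the usual topology of the sphere. -/
theorem topology_eq (d : ℕ) :
    (inferInstance : TopologicalSpace (Sphere d)) =
      (angularMetric d).toUniformSpace.toTopologicalSpace := by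
  apply le_antisymm
  · rw [← continuous_id_iff_le]
    let m := angularMetric d
    rw [@continuous_iff_continuous_dist _ _ m.toPseudoMetricSpace (inferInstance)]
    change Continuous fun p : Sphere d × Sphere d =>
      Real.arccos (inner ℝ p.1.vec p.2.vec / (‖p.1.vec‖ * ‖p.2.vec‖))
    simp only [norm_vec, mul_one, div_one]
    exact Real.continuous_arccos.comp
      ((continuous_vec.comp continuous_fst).inner (continuous_vec.comp continuous_snd))
  · rw [isEmbedding_vec.eq_induced, ← continuous_iff_le_induced]
    let m := angularMetric d
    refine @LipschitzWith.continuous _ _ m.toPseudoMetricSpace.toPseudoEMetricSpace _ 1 _ ?_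
    refine @LipschitzWith.of_dist_le_mul _ _ m.toPseudoMetricSpace _ 1 _ fun x y => ?_
    change dist x.vec y.vec ≤ 1 * InnerProductGeometry.angle x.vec y.vec
    rw [one_mul, dist_eq_norm]
    have h0 := InnerProductGeometry.angle_nonneg x.vec y.vec
    refine abs_le_of_sq_le_sq' ?_ h0 |>.2
    have h1 := norm_sub_sq_real x.vec y.vec
    rw [InnerProductGeometry.inner_eq_cos_angle_of_norm_eq_one (norm_vec x) (norm_vec y),
      norm_vec, norm_vec] at h1
    have h2 := Real.one_sub_sq_div_two_le_cos (x := InnerProductGeometry.angle x.vec y.vec)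
    rw [h1]
    linarith

/-- The sphere with its geodesic metric. -/
noncomputable instance : MetricSpace (Sphere d) :=
  (angularMetric d).replaceTopology (topology_eq d)

theorem dist_eq_angle (x y : Sphere d) : dist x y = InnerProductGeometry.angle x.vec y.vec := rfl

theorem dist_neg_neg (x y : Sphere d) : dist (-x) (-y) = dist x y := by
  simp only [dist_eq_angle, vec_neg, InnerProductGeometry.angle_neg_neg]

theorem dist_neg_left (x y : Sphere d) : dist (-x) y = dist x (-y) := by
  rw [← dist_neg_neg, neg_neg]

end Sphere

/-- The equivalence relation `x ∼ ±x` on the sphere. -/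
def antipodalSetoid (d : ℕ) : Setoid (Sphere d) where
  r x y := x = y ∨ x = -y
  iseqv :=
    { refl := fun _ => Or.inl rfl
      symm := by
        rintro x y (rfl | rfl)
        · exact Or.inl rfl
        · exact Or.inr (neg_neg y).symm
      trans := by
        rintro x y z (rfl | rfl) (rfl | rfl)
        · exact Or.inl rfl
        · exact Or.inr rfl
        · exact Or.inr rfl
        · exact Or.inl (neg_neg z) }

/-- Real projective space `ℝP^d`, the quotient of `S^d` by the antipodal involution. -/
def RealProjectiveSpace (d : ℕ) : Type := Quotient (antipodalSetoid d)

namespace RealProjectiveSpace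

variable {d : ℕ}

/-- The quotient map `S^d → ℝP^d`. -/
def mk (x : Sphere d) : RealProjectiveSpace d := Quotient.mk (antipodalSetoid d) x

theorem mk_surjective : Function.Surjective (mk : Sphere d → _) := Quotient.mk_surjective

/-- The quotient distance: the minimal geodesic distance between representatives. -/
noncomputable def qdist (p q : RealProjectiveSpace d) : ℝ :=
  Quotient.liftOn₂ p q (fun x y => min (dist x y) (dist x (-y))) (by
    rintro x y x' y' (rfl | rfl) (rfl | rfl)
    · rfl
    · simp only [neg_neg, min_comm]
    · simp only [Sphere.dist_neg_left, neg_neg, min_comm]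
    · simp only [Sphere.dist_neg_left, neg_neg])

/-- `ℝP^d` with the quotient of the geodesic metric. -/
noncomputable instance : MetricSpace (RealProjectiveSpace d) where
  dist := qdist
  dist_self p := by
    obtain ⟨x, rfl⟩ := mk_surjective p
    change min (dist x x) (dist x (-x)) = 0
    rw [dist_self, min_eq_left dist_nonneg]
  dist_comm p q := by
    obtain ⟨x, rfl⟩ := mk_surjective p
    obtain ⟨y, rfl⟩ := mk_surjective q
    change min (dist x y) (dist x (-y)) = min (dist y x) (dist y (-x))
    rw [dist_comm x y, dist_comm x (-y), Sphere.dist_neg_left]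
  dist_triangle p q r := by
    obtain ⟨x, rfl⟩ := mk_surjective p
    obtain ⟨y, rfl⟩ := mk_surjective q
    obtain ⟨z, rfl⟩ := mk_surjective r
    change min (dist x z) (dist x (-z)) ≤
      min (dist x y) (dist x (-y)) + min (dist y z) (dist y (-z))
    have h1 := dist_triangle x y z
    have h2 := dist_triangle x y (-z)
    have h3 := dist_triangle x (-y) z
    have h4 := dist_triangle x (-y) (-z)
    rw [Sphere.dist_neg_left] at h3
    rw [Sphere.dist_neg_neg] at h4
    rcases min_choice (dist x y) (dist x (-y)) with h | h <;>
    rcases min_choice (dist y z) (dist y (-z)) with h' | h' <;> rw [h, h']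
    · exact (min_le_left _ _).trans h1
    · exact (min_le_right _ _).trans h2
    · exact (min_le_right _ _).trans h4
    · exact (min_le_left _ _).trans h3
  eq_of_dist_eq_zero {p q} h := by
    obtain ⟨x, rfl⟩ := mk_surjective p
    obtain ⟨y, rfl⟩ := mk_surjective q
    change min (dist x y) (dist x (-y)) = 0 at h
    refine Quotient.sound ?_
    rcases min_choice (dist x y) (dist x (-y)) with h' | h' <;> rw [h'] at h
    · exact Or.inl (eq_of_dist_eq_zero h)
    · exact Or.inr (eq_of_dist_eq_zero h)

theorem dist_mk (x y : Sphere d) : dist (mk x) (mk y) = min (dist x y) (dist x (-y)) := rfl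

theorem continuous_mk : Continuous (mk : Sphere d → _) :=
  (LipschitzWith.of_dist_le_mul (K := 1) fun x y => by
    rw [dist_mk, NNReal.coe_one, one_mul]
    exact min_le_left _ _).continuous

instance : CompactSpace (RealProjectiveSpace d) :=
  mk_surjective.compactSpace continuous_mk

end RealProjectiveSpace

/-- `p_n(X)`: the supremum of all `ε > 0` for which there are `n` points of `X` with pairwise
distances at least `ε`. -/
noncomputable def packingDistance (n : ℕ) (X : Type*) [MetricSpace X] [CompactSpace X] : ℝ :=
  sSup {ε : ℝ | 0 < ε ∧ ∃ x : Fin n → X, ∀ i j, i ≠ j → ε ≤ dist (x i) (x j)}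

/-- The `ℤ/2`-Carathéodory number `c_n(X)` of a compact metric space with an involution `x ↦ -x`:
the infimum of all `t ≥ 0` such that every continuous odd map `f : X → ℝ^n` admits a set `A ⊆ X`
of diameter at most `t` with `0 ∈ conv (f(A))`. -/
noncomputable def caratheodoryNumber (n : ℕ) (X : Type*) [MetricSpace X] [CompactSpace X]
    [InvolutiveNeg X] : ℝ :=
  sInf {t : ℝ | 0 ≤ t ∧ ∀ f : X → EuclideanSpace ℝ (Fin n), Continuous f →
    (∀ x, f (-x) = -f x) → ∃ A : Set X, Metric.diam A ≤ t ∧ 0 ∈ convexHull ℝ (f '' A)}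

end ProjCode

namespace ProjCode

open Finset Module

/-! Suppose no `A i` contains an antipodal pair. Each of the first `n` sets, being open or closed,
admits a continuous odd function positive on it (`Sphere.exists_odd_pos`); together these form an
odd map `f` to `ℝ^n`. Compactness turns the infimum defining `caratheodoryNumber` into an actual set
`B` of diameter at most that number with `0` in the hull of `f(B)`. Such a `B` lies in none of the
first `n` sets, where a coordinate of `f` is positive, so it lies in the last one. The same holds
for `-B`, and any `x ∈ B` yields an antipodal pair.

The bound by projective codes is linear algebra: the images of `n + 1` points in `ℝ^n` are
dependent, and flipping points makes the coefficients nonnegative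
(`exists_signs_zero_mem_convexHull`). -/

/-- A weighted point configuration witnessing membership in the convex hull of a family. -/
theorem exists_mem_stdSimplex_of_mem_convexHull_range {ι E : Type*} [Fintype ι]
    [AddCommGroup E] [Module ℝ E] {y : ι → E} {z : E} (hz : z ∈ convexHull ℝ (Set.range y)) :
    ∃ w ∈ stdSimplex ℝ ι, ∑ i, w i • y i = z := by
  classical
  have h : Fintype.linearCombination ℝ y '' stdSimplex ℝ ι = convexHull ℝ (Set.range y) := by
    rw [← convexHull_rangle_single_eq_stdSimplex, LinearMap.image_convexHull, ← Set.range_comp]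
    congr 2
    ext i
    simp
  rw [← h] at hz
  obtain ⟨w, hw, rfl⟩ := hz
  exact ⟨w, hw, by simp [Fintype.linearCombination_apply]⟩

/-- Carathéodory's theorem for the image of a map, with a fixed number of points. -/
theorem exists_range_mem_convexHull {n : ℕ} {X E : Type*} [AddCommGroup E] [Module ℝ E]
    [FiniteDimensional ℝ E] (hE : finrank ℝ E = n) {f : X → E} {A : Set X} {z : E}
    (hz : z ∈ convexHull ℝ (f '' A)) :
    ∃ x : Fin (n + 1) → X, (∀ i, x i ∈ A) ∧ z ∈ convexHull ℝ (Set.range (f ∘ x)) := by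
  rw [convexHull_eq_union] at hz
  simp only [Set.mem_iUnion] at hz
  obtain ⟨t, htA, hai, hzt⟩ := hz
  have hne : t.Nonempty := by
    rw [← Finset.coe_nonempty, ← convexHull_nonempty_iff (𝕜 := ℝ)]
    exact ⟨z, hzt⟩
  have hcard : Fintype.card t ≤ Fintype.card (Fin (n + 1)) := by
    have h := hai.card_le_finrank_succ
    have h' := Submodule.finrank_le (vectorSpan ℝ (Set.range ((↑) : t → E)))
    rw [Fintype.card_fin]
    omega
  have : Nonempty t := hne.to_subtype
  obtain ⟨e⟩ := Function.Embedding.nonempty_of_card_le hcard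
  -- A surjection from `Fin (n + 1)` pads the at most `n + 1` points by repetition, so that all
  -- configurations live in one compact space.
  have hsurj := Function.invFun_surjective e.injective
  choose x hxA hx using fun i => htA (Function.invFun e i).2
  refine ⟨x, hxA, ?_⟩
  have hfx : f ∘ x = (↑) ∘ Function.invFun e := funext hx
  rw [hfx, hsurj.range_comp]
  simpa using hzt

/-- The infimum over the diameters of sets whose image under a fixed continuous map has a given
point in its convex hull is attained. -/
theorem exists_diam_le_of_forall_lt {X E : Type*} [MetricSpace X] [CompactSpace X]
    [NormedAddCommGroup E] [NormedSpace ℝ E] [FiniteDimensional ℝ E] {f : X → E}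
    (hf : Continuous f) {z : E} {c : ℝ}
    (h : ∀ t, c < t → ∃ A : Set X, Metric.diam A ≤ t ∧ z ∈ convexHull ℝ (f '' A)) :
    ∃ A : Set X, Metric.diam A ≤ c ∧ z ∈ convexHull ℝ (f '' A) := by
  obtain ⟨n, hn⟩ : ∃ n, finrank ℝ E = n := ⟨_, rfl⟩
  -- `K` is compact and the largest pairwise distance `D` is continuous; a minimiser of `D` on `K`
  -- satisfies `D ≤ t` for every `t > c`, hence `D ≤ c`.
  let K : Set ((Fin (n + 1) → X) × (Fin (n + 1) → ℝ)) :=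
    (Set.univ ×ˢ stdSimplex ℝ (Fin (n + 1))) ∩ {p | ∑ i, p.2 i • f (p.1 i) = z}
  have hK : IsCompact K := by
    refine (isCompact_univ.prod (isCompact_stdSimplex ℝ _)).inter_right ?_
    exact isClosed_eq (by fun_prop) continuous_const
  let D : (Fin (n + 1) → X) × (Fin (n + 1) → ℝ) → ℝ := fun p =>
    (univ : Finset (Fin (n + 1) × Fin (n + 1))).sup' univ_nonempty
      fun ij => dist (p.1 ij.1) (p.1 ij.2)
  have hD : Continuous D := Continuous.finset_sup'_apply _ fun ij _ => by fun_prop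
  have hlt : ∀ t, c < t → ∃ p ∈ K, D p ≤ t := by
    intro t ht
    obtain ⟨A, hAt, hzA⟩ := h t ht
    obtain ⟨x, hxA, hx⟩ := exists_range_mem_convexHull hn hzA
    obtain ⟨w, hw, hwz⟩ := exists_mem_stdSimplex_of_mem_convexHull_range hx
    refine ⟨(x, w), ⟨⟨trivial, hw⟩, hwz⟩, Finset.sup'_le _ _ fun ij _ => ?_⟩
    exact (Metric.dist_le_diam_of_mem (Metric.isBounded_of_compactSpace) (hxA _) (hxA _)).trans hAt
  obtain ⟨p₀, hp₀, -⟩ := hlt (c + 1) (by linarith)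
  obtain ⟨p, hp, hmin⟩ := hK.exists_isMinOn ⟨p₀, hp₀⟩ hD.continuousOn
  have hDc : D p ≤ c := le_of_forall_gt_imp_ge_of_dense fun t ht => by
    obtain ⟨q, hq, hqt⟩ := hlt t ht
    exact (hmin hq).trans hqt
  have hdist : ∀ i j, dist (p.1 i) (p.1 j) ≤ D p := fun i j =>
    Finset.le_sup' (fun ij : Fin (n + 1) × Fin (n + 1) => dist (p.1 ij.1) (p.1 ij.2))
      (mem_univ (i, j))
  refine ⟨Set.range p.1, ?_, ?_⟩
  · refine (Metric.diam_le_of_forall_dist_le (dist_nonneg.trans (hdist 0 0)) ?_).trans hDc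
    rintro _ ⟨i, rfl⟩ _ ⟨j, rfl⟩
    exact hdist i j
  · rw [← hp.2]
    exact (convex_convexHull ℝ _).sum_mem (fun i _ => hp.1.2.1 i) hp.1.2.2
      fun i _ => subset_convexHull ℝ _ ⟨_, ⟨i, rfl⟩, rfl⟩

/-! ### Antipodes and odd functions on the sphere -/

namespace Sphere

variable {d : ℕ}

theorem dist_neg_right (x y : Sphere d) : dist x (-y) = Real.pi - dist x y := by
  simp only [dist_eq_angle, vec_neg, InnerProductGeometry.angle_neg_right]

theorem dist_le_pi (x y : Sphere d) : dist x y ≤ Real.pi := InnerProductGeometry.angle_le_pi _ _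

theorem continuous_neg : Continuous (Neg.neg : Sphere d → Sphere d) :=
  (Isometry.of_dist_eq dist_neg_neg).continuous

theorem diam_neg_image (A : Set (Sphere d)) : Metric.diam (Neg.neg '' A) = Metric.diam A :=
  (Isometry.of_dist_eq dist_neg_neg).diam_image A

theorem diam_le_pi (A : Set (Sphere d)) : Metric.diam A ≤ Real.pi :=
  Metric.diam_le_of_forall_dist_le Real.pi_pos.le fun x _ y _ => dist_le_pi x y

/-- An open or closed set without antipodal points is separated from its antipode by a continuous
odd function. -/
theorem exists_odd_pos {A : Set (Sphere d)} (hA : IsOpen A ∨ IsClosed A)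
    (hanti : ∀ x ∈ A, -x ∉ A) :
    ∃ g : Sphere d → ℝ, Continuous g ∧ (∀ x, g (-x) = -g x) ∧ ∀ x ∈ A, 0 < g x := by
  rcases A.eq_empty_or_nonempty with rfl | ⟨a, ha⟩
  · exact ⟨fun _ => 0, continuous_const, by simp, by simp⟩
  rcases hA with hA | hA
  · refine ⟨fun x => Metric.infDist x Aᶜ - Metric.infDist (-x) Aᶜ, ?_, fun x => ?_, fun x hx => ?_⟩
    · exact (Metric.continuous_infDist_pt _).sub
        ((Metric.continuous_infDist_pt _).comp continuous_neg)
    · simp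
    · have h1 := (hA.isClosed_compl.notMem_iff_infDist_pos ⟨-a, hanti a ha⟩).1
        (not_not.2 hx : x ∉ Aᶜ)
      have h2 := Metric.infDist_zero_of_mem (show -x ∈ Aᶜ from hanti x hx)
      linarith
  · refine ⟨fun x => Metric.infDist (-x) A - Metric.infDist x A, ?_, fun x => ?_, fun x hx => ?_⟩
    · exact ((Metric.continuous_infDist_pt _).comp continuous_neg).sub
        (Metric.continuous_infDist_pt _)
    · simp
    · have h1 := (hA.notMem_iff_infDist_pos ⟨a, ha⟩).1 (hanti x hx)
      have h2 := Metric.infDist_zero_of_mem hx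
      linarith

end Sphere

/-- On the sphere, the infimum defining the Carathéodory number is attained for each odd map. -/
theorem exists_diam_le_caratheodoryNumber {d n : ℕ} {f : Sphere d → EuclideanSpace ℝ (Fin n)}
    (hf : Continuous f) (hodd : ∀ x, f (-x) = -f x) :
    ∃ A : Set (Sphere d), Metric.diam A ≤ caratheodoryNumber n (Sphere d) ∧
      0 ∈ convexHull ℝ (f '' A) := by
  refine exists_diam_le_of_forall_lt hf fun t ht => ?_
  have hne : Nonempty (Sphere d) :=
    (NormedSpace.sphere_nonempty.2 zero_le_one : (Metric.sphere (0 :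
      EuclideanSpace ℝ (Fin (d + 1))) 1).Nonempty).to_subtype
  obtain ⟨x⟩ := hne
  -- The value `π` is always admissible: an odd map sends `{x, -x}` to a pair with midpoint `0`.
  obtain ⟨s, ⟨-, hs⟩, hst⟩ := exists_lt_of_csInf_lt (by
    refine ⟨Real.pi, Real.pi_pos.le, fun g _ hg => ⟨{x, -x}, Sphere.diam_le_pi _, ?_⟩⟩
    rw [Set.image_pair, hg, convexHull_pair]
    exact ⟨1 / 2, 1 / 2, by norm_num, by norm_num, by norm_num, by simp⟩) ht
  obtain ⟨A, hA, h0⟩ := hs f hf hodd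
  exact ⟨A, hA.trans hst.le, h0⟩

/-! ### Comparison with projective codes -/

/-- Any `n + 1` points of the sphere have suitable signs with the origin in the convex hull of
the image of the signed points under an odd map to `ℝ^n`. -/
theorem exists_signs_zero_mem_convexHull {n : ℕ} {X E : Type*} [InvolutiveNeg X]
    [AddCommGroup E] [Module ℝ E] [FiniteDimensional ℝ E] (hE : finrank ℝ E = n) {f : X → E}
    (hodd : ∀ x, f (-x) = -f x) (x : Fin (n + 1) → X) :
    ∃ y : Fin (n + 1) → X, (∀ i, y i = x i ∨ y i = -x i) ∧
      0 ∈ convexHull ℝ (Set.range (f ∘ y)) := by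
  have hdep : ¬ LinearIndependent ℝ (f ∘ x) := fun h => by
    have := h.fintype_card_le_finrank
    rw [Fintype.card_fin] at this
    omega
  obtain ⟨w, hw, i₀, hi₀⟩ := Fintype.not_linearIndependent_iff.1 hdep
  -- The signs of the linear relation are moved into the points, leaving the weights `|w i|`.
  let y : Fin (n + 1) → X := fun i => if 0 ≤ w i then x i else -x i
  have hy : ∀ i, |w i| • f (y i) = w i • f (x i) := by
    intro i
    rcases le_or_gt 0 (w i) with h | h
    · simp [y, h, abs_of_nonneg h]
    · simp [y, h.not_ge, abs_of_neg h, hodd]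
  refine ⟨y, fun i => ?_, ?_⟩
  · by_cases h : 0 ≤ w i <;> simp [y, h]
  · have hpos : 0 < ∑ i, |w i| := Finset.sum_pos' (fun i _ => abs_nonneg _)
      ⟨i₀, mem_univ _, abs_pos.2 hi₀⟩
    have h := (univ : Finset (Fin (n + 1))).centerMass_mem_convexHull (R := ℝ)
      (w := fun i => |w i|) (z := f ∘ y) (fun i _ => abs_nonneg _) hpos
      (s := Set.range (f ∘ y)) fun i _ => ⟨i, rfl⟩
    have hz : (univ : Finset (Fin (n + 1))).centerMass (fun i => |w i|) (f ∘ y) = 0 := by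
      simp only [Finset.centerMass, Function.comp_apply, hy]
      simp only [Function.comp_apply] at hw
      rw [hw, smul_zero]
    rwa [hz] at h

/-- Projective codes bound the Carathéodory number of the sphere. -/
theorem caratheodoryNumber_le {d n : ℕ} (hn : 1 ≤ n) :
    caratheodoryNumber n (Sphere d) ≤
      Real.pi - packingDistance (n + 1) (RealProjectiveSpace d) := by
  have hbdd : BddBelow {t : ℝ | 0 ≤ t ∧ ∀ f : Sphere d → EuclideanSpace ℝ (Fin n),
      Continuous f → (∀ x, f (-x) = -f x) → ∃ A : Set (Sphere d), Metric.diam A ≤ t ∧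
        0 ∈ convexHull ℝ (f '' A)} := ⟨0, fun t ht => ht.1⟩
  rw [le_sub_comm]
  refine Real.sSup_le ?_ ?_
  · rintro ε ⟨-, p, hp⟩
    choose x hx using fun i => RealProjectiveSpace.mk_surjective (p i)
    -- The interval `[ε, π - ε]` is invariant under `t ↦ π - t`, so every choice of signs keeps the
    -- distances at most `π - ε`.
    have hxε : ∀ i j, i ≠ j → ε ≤ dist (x i) (x j) ∧ dist (x i) (x j) ≤ Real.pi - ε := by
      intro i j hij
      have h := hp i j hij
      rw [← hx i, ← hx j, RealProjectiveSpace.dist_mk, le_min_iff, Sphere.dist_neg_right] at h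
      exact ⟨h.1, by linarith [h.2]⟩
    have hε : 0 ≤ Real.pi - ε := by
      have h01 : (0 : Fin (n + 1)) ≠ Fin.last n := by
        simp only [ne_eq, Fin.ext_iff, Fin.val_zero, Fin.val_last]
        omega
      exact dist_nonneg.trans (hxε _ _ h01).2
    rw [le_sub_comm]
    refine csInf_le hbdd ⟨hε, fun f _ hodd => ?_⟩
    obtain ⟨y, hy, h0⟩ := exists_signs_zero_mem_convexHull finrank_euclideanSpace_fin hodd x
    refine ⟨Set.range y, Metric.diam_le_of_forall_dist_le hε ?_, by rwa [← Set.range_comp]⟩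
    rintro _ ⟨i, rfl⟩ _ ⟨j, rfl⟩
    rcases eq_or_ne i j with rfl | hij
    · rwa [dist_self]
    have h := hxε i j hij
    rcases hy i with hi | hi <;> rcases hy j with hj | hj <;> rw [hi, hj]
    · exact h.2
    · rw [Sphere.dist_neg_right]; linarith [h.1]
    · rw [Sphere.dist_neg_left, Sphere.dist_neg_right]; linarith [h.1]
    · rw [Sphere.dist_neg_neg]; exact h.2
  -- `Real.sSup_le` needs a nonnegative bound, since the supremum of the empty set is `0`.
  · rw [sub_nonneg]
    refine csInf_le hbdd ⟨Real.pi_pos.le, fun f hf hodd => ?_⟩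
    obtain ⟨A, -, h0⟩ := exists_diam_le_caratheodoryNumber hf hodd
    exact ⟨A, Sphere.diam_le_pi A, h0⟩

/-! ### The covering theorem -/

/-- If a set is contained in a half space given by a coordinate, so is its convex hull. -/
theorem zero_notMem_convexHull_of_pos {n : ℕ} {s : Set (EuclideanSpace ℝ (Fin n))} (i : Fin n)
    (hs : ∀ y ∈ s, 0 < y i) : 0 ∉ convexHull ℝ s := fun h => by
  have hconv : Convex ℝ {y : EuclideanSpace ℝ (Fin n) | 0 < EuclideanSpace.proj (𝕜 := ℝ) i y} :=
    convex_halfSpace_gt (EuclideanSpace.proj (𝕜 := ℝ) i).isLinear 0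
  exact lt_irrefl (0 : ℝ) (convexHull_min hs hconv h)

/-- Only the first `n` sets contribute coordinates; the last set, about which nothing topological is
known, is caught by applying the hypothesis to both `B` and `-B`. -/
theorem exists_antipodal_of_caratheodoryNumber {d n : ℕ} {A : Fin (n + 1) → Set (Sphere d)}
    (hA : ∀ i : Fin n, IsOpen (A i.castSucc) ∨ IsClosed (A i.castSucc))
    (hB : ∀ B : Set (Sphere d), Metric.diam B ≤ caratheodoryNumber n (Sphere d) →
      ∃ i, B ⊆ A i) :
    ∃ i, ∃ x, x ∈ A i ∧ -x ∈ A i := by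
  by_contra! hanti
  choose g hg hgodd hgpos using fun i : Fin n => Sphere.exists_odd_pos (hA i) (hanti _)
  let f : Sphere d → EuclideanSpace ℝ (Fin n) := fun x => WithLp.toLp 2 fun i => g i x
  have hf : Continuous f := by fun_prop
  have hodd : ∀ x, f (-x) = -f x := fun x => by
    ext i
    simp [f, hgodd]
  obtain ⟨B, hBd, h0⟩ := exists_diam_le_caratheodoryNumber hf hodd
  have hlast : ∀ C : Set (Sphere d), Metric.diam C ≤ caratheodoryNumber n (Sphere d) →
      0 ∈ convexHull ℝ (f '' C) → C ⊆ A (Fin.last n) := by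
    intro C hC h0C
    obtain ⟨i, hi⟩ := hB C hC
    induction i using Fin.lastCases with
    | last => exact hi
    | cast i =>
      refine absurd h0C (zero_notMem_convexHull_of_pos i ?_)
      rintro _ ⟨x, hx, rfl⟩
      exact hgpos i x (hi hx)
  have hneg : (0 : EuclideanSpace ℝ (Fin n)) ∈ convexHull ℝ (f '' (Neg.neg '' B)) := by
    have : f '' (Neg.neg '' B) = -(f '' B) := by
      rw [← Set.image_neg_eq_neg, Set.image_image, Set.image_image]
      exact Set.image_congr fun x _ => hodd x
    rw [this, convexHull_neg, Set.mem_neg, neg_zero]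
    exact h0
  obtain ⟨_, x, hx, -⟩ := convexHull_nonempty_iff.1 ⟨_, h0⟩
  exact hanti _ x (hlast B hBd h0 hx)
    (hlast _ ((Sphere.diam_neg_image B).trans_le hBd) hneg ⟨x, hx, rfl⟩)

end ProjCode

theorem mainTheorem10 (d n : ℕ) (hd : 1 ≤ d) (hn : d ≤ n)
    (A : Fin (n + 1) → Set (ProjCode.Sphere d))
    (hcover : ⋃ i, A i = Set.univ)
    (hA : ∀ i : Fin n, IsOpen (A i.castSucc) ∨ IsClosed (A i.castSucc)) :
    ((∀ B : Set (ProjCode.Sphere d),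
        Metric.diam B ≤ ProjCode.caratheodoryNumber n (ProjCode.Sphere d) → ∃ i, B ⊆ A i) →
      ∃ i, ∃ x, x ∈ A i ∧ -x ∈ A i) ∧
    ((∀ B : Set (ProjCode.Sphere d),
        Metric.diam B ≤
          Real.pi - ProjCode.packingDistance (n + 1) (ProjCode.RealProjectiveSpace d) →
        ∃ i, B ⊆ A i) →
      ∀ B : Set (ProjCode.Sphere d),
        Metric.diam B ≤ ProjCode.caratheodoryNumber n (ProjCode.Sphere d) → ∃ i, B ⊆ A i) := by
  exact ⟨ProjCode.exists_antipodal_of_caratheodoryNumber hA,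
    fun h B hB => h B (hB.trans (ProjCode.caratheodoryNumber_le (hd.trans hn)))⟩
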